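/- Let $G=(V,E)$ be a finite connected loopless graph (multiple edges allowed) and let $\mathbb E$ be the set of its oriented edges; each edge gives two of them, $e=uv$ (tail $u$, head $v$) and its reverse $\overline e=vu$. Let $C^1(G,\mathbb R)$ be the space of functions $x:\mathbb E\to\mathbb R$ with $x_{\overline e}=-x_e$, with the scalar product $\langle x,y\rangle=\sum_{E}x_ey_e=\frac12\sum_{e\in\mathbb E}x_ey_e$ and norm $\|\cdot\|$. For $f:V\to\mathbb R$ put $d(f)_{uv}=f(v)-f(u)$. Let $F_{\mathbb R}=d(\mathbb R^V)$ be the cut space, $F_{\mathbb Z}=d(\mathbb Z^V)$ the cut lattice, $\pi_F:C^1(G,\mathbb R)\to F_{\mathbb R}$ the orthogonal projection, and $$\mathrm{Vor}_F(O)=\{x\in F_{\mathbb R}:\ \|x\|\le\|x-\mu\|\ \text{ for all }\mu\in F_{\mathbb Z}\}$$ the Voronoi cell of the origin. A bond element is an element $\beta=d(\chi_C)$ with $C\subseteq V$ such that the induced subgraphs $G[C]$ and $G[V\setminus C]$ are both connected (in particular non-empty); put $F_\beta=\{x\in F_{\mathbb R}: 2\langle x,\beta\rangle=\|\beta\|^2\}$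 and $\mathrm{supp}^+(\beta)=\{e\in\mathbb E:\beta_e>0\}$. For a non-empty face $\mathfrak f$ of $\mathrm{Vor}_F(O)$ let $\phi(\mathfrak f)\subseteq\mathbb E$ be the union of the sets $\mathrm{supp}^+(\beta)$ over all bond elements $\beta$ with $\mathfrak f\subseteq F_\beta$. Let $D$ be a coherent acyclic orientation of a cut subgraph of $G$: there is an ordered partition $V_1,\dots,V_s$ of $V$ into non-empty sets such that the set $\mathbb E(D)$ of oriented edges of $D$ consists of all $uv\in\mathbb E$ with $u\in V_i$, $v\in V_j$ and $i<j$. Let $\chi_D\in C^1(G,\mathbb R)$ take the value $1$ on $\mathbb E(D)$, $-1$ on the reverses of elements of $\mathbb E(D)$, and $0$ elsewhere. Let $X_1,\dots,X_{d+1}$ be the connected components of $G-E(D)$, where $E(D)$ is the set of underlying edges of $D$. For each $i$, view $C^1(X_i,\mathbb R)$ as a subspace of $C^1(G,\mathbb R)$ by extending by zero, let $\square_{i,0}=\{x\in C^1(X_i,\mathbb R): |x_e|\le\frac12\ \text{for all } e\}$, and let $\mathrm{Vor}_{F_i}(O)$ be the Voronoi cell of the origin in the cut space $F_{i,\mathbb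 R}$ of $X_i$ with respect to the cut lattice $F_{i,\mathbb Z}$ of $X_i$. Put $\square_{D,0}=\frac12\chi_D+\sum_i\square_{i,0}$. Then there is exactly one non-empty face $\mathfrak f_D$ of $\mathrm{Vor}_F(O)$ with $\phi(\mathfrak f_D)=\mathbb E(D)$, and the following hold. 1. $\pi_F(\square_{D,0})=\mathfrak f_D$. 2. $\pi_F$ maps the (relative) interior of $\square_{D,0}$ onto the (relative) interior of $\mathfrak f_D$. 3. $\pi_F$ restricts to an isomorphism of polytopes from $\mathrm{Vor}_{F_1}(O)+\dots+\mathrm{Vor}_{F_{d+1}}(O)+\frac12\chi_D$ onto $\mathfrak f_D$: it maps this Minkowski sum bijectively onto $\mathfrak f_D$, and its affine span bijectively onto the affine span of $\mathfrak f_D$. -/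

import Mathlib

/-! Finite multigraphs are Mathlib's `Graph α β` (vertices in `α`, edges in `β`, both finite). -/

namespace CutVoronoi

open scoped Graph Pointwise

universe u v

variable {α : Type u} {β : Type v}

/-- An edge of `G` together with a choice of one of its two orientations. -/
@[ext]
structure OrientedEdge (G : Graph α β) where
  edge : β
  tail : α
  head : α
  isLink : G.IsLink edge tail head

namespace OrientedEdge

variable {G : Graph α β}

/-- The reverse oriented edge. -/
def rev (e : OrientedEdge G) : OrientedEdge G where
  edge := e.edge
  tail := e.head
  head := e.tail
  isLink := e.isLink.symm

/-- The tail, as a vertex of `G`. -/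
def tailV (e : OrientedEdge G) : V(G) := ⟨e.tail, e.isLink.left_mem⟩

/-- The head, as a vertex of `G`. -/
def headV (e : OrientedEdge G) : V(G) := ⟨e.head, e.isLink.right_mem⟩

@[simp] lemma rev_rev (e : OrientedEdge G) : e.rev.rev = e := rfl
@[simp] lemma tailV_rev (e : OrientedEdge G) : e.rev.tailV = e.headV := rfl
@[simp] lemma headV_rev (e : OrientedEdge G) : e.rev.headV = e.tailV := rfl

instance [Finite α] [Finite β] : Finite (OrientedEdge G) :=
  Finite.of_injective (fun e : OrientedEdge G => (e.edge, e.tail, e.head)) (by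
    intro e f h
    simp only [Prod.mk.injEq] at h
    exact OrientedEdge.ext h.1 h.2.1 h.2.2)

noncomputable instance [Finite α] [Finite β] : Fintype (OrientedEdge G) := Fintype.ofFinite _

end OrientedEdge

/-- The submodule of functions on oriented edges that change sign under reversal. -/
def antisymmetric (G : Graph α β) : Submodule ℝ (OrientedEdge G → ℝ) where
  carrier := {g | ∀ e, g e.rev = - g e}
  add_mem' := by
    intro a b ha hb e
    simp only [Pi.add_apply, ha e, hb e]
    ring
  zero_mem' := by intro e; simp
  smul_mem' := by
    intro c a ha e
    simp only [Pi.smul_apply, smul_eq_mul, ha e]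
    ring

/-- `C¹(G, ℝ)`. It is a type of its own because it carries the Euclidean norm and not the
supremum norm of the function space. -/
def CochainOne (G : Graph α β) : Type _ := antisymmetric G

namespace CochainOne

variable {G : Graph α β}

instance : AddCommGroup (CochainOne G) := inferInstanceAs (AddCommGroup (antisymmetric G))
instance : Module ℝ (CochainOne G) := inferInstanceAs (Module ℝ (antisymmetric G))

/-- The function on oriented edges underlying an element of `C¹(G, ℝ)`. -/
def val (x : CochainOne G) : OrientedEdge G → ℝ := Subtype.val (p := (· ∈ antisymmetric G)) x

/-- The element of `C¹(G, ℝ)` given by an antisymmetric function. -/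
def mk (g : OrientedEdge G → ℝ) (hg : ∀ e, g e.rev = - g e) : CochainOne G :=
  (⟨g, hg⟩ : antisymmetric G)

instance : CoeFun (CochainOne G) (fun _ => OrientedEdge G → ℝ) := ⟨val⟩

@[simp] lemma mk_apply (g : OrientedEdge G → ℝ) (hg : ∀ e, g e.rev = - g e) (e : OrientedEdge G) :
    mk g hg e = g e := rfl
lemma apply_rev (x : CochainOne G) (e : OrientedEdge G) : x e.rev = - x e := x.2 e
@[ext] lemma ext {x y : CochainOne G} (h : ∀ e, x e = y e) : x = y := Subtype.ext (funext h)
@[simp] lemma add_apply (x y : CochainOne G) (e : OrientedEdge G) : (x + y) e = x e + y e := rfl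
@[simp] lemma smul_apply (c : ℝ) (x : CochainOne G) (e : OrientedEdge G) :
    (c • x) e = c * x e := rfl
@[simp] lemma zero_apply (e : OrientedEdge G) : (0 : CochainOne G) e = 0 := rfl

variable [Finite α] [Finite β]

instance : FiniteDimensional ℝ (CochainOne G) :=
  inferInstanceAs (FiniteDimensional ℝ (antisymmetric G))

/-- The scalar product `∑ x_e y_e`, each edge being counted once: the sum over all oriented edges
counts every edge twice. -/
@[reducible]
noncomputable def innerCore : InnerProductSpace.Core ℝ (CochainOne G) where
  inner x y := (∑ e : OrientedEdge G, x e * y e) / 2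
  conj_inner_symm x y := by simp [mul_comm]
  re_inner_nonneg x := by
    simpa using div_nonneg (Finset.sum_nonneg fun e _ => mul_self_nonneg (x e)) (by norm_num)
  add_left x y z := by
    simp only [add_apply, add_mul, Finset.sum_add_distrib, add_div]
  smul_left x y r := by
    simp only [smul_apply, mul_assoc, ← Finset.mul_sum, mul_div_assoc]
    simp
  definite x h := by
    have h' : ∑ e : OrientedEdge G, x e * x e = 0 := by
      have h2 : (∑ e : OrientedEdge G, x e * x e) / 2 = 0 := h
      linarith
    rw [Finset.sum_eq_zero_iff_of_nonneg fun e _ => mul_self_nonneg (x e)] at h'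
    exact ext fun e => mul_self_eq_zero.mp (h' e (Finset.mem_univ e))

noncomputable instance : NormedAddCommGroup (CochainOne G) :=
  innerCore.toNormedAddCommGroup

noncomputable instance : InnerProductSpace ℝ (CochainOne G) :=
  InnerProductSpace.ofCore innerCore.toCore

lemma inner_def (x y : CochainOne G) :
    inner ℝ x y = (∑ e : OrientedEdge G, x e * y e) / 2 := rfl

end CochainOne

lemma coboundary_rev {G : Graph α β} (f : V(G) → ℝ) (e : OrientedEdge G) :
    f e.rev.headV - f e.rev.tailV = -(f e.headV - f e.tailV) := by simp

/-- The coboundary `d : C⁰(G, ℝ) → C¹(G, ℝ)`, `d(f)(uv) = f(v) - f(u)`. -/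
def coboundary (G : Graph α β) : (V(G) → ℝ) →ₗ[ℝ] CochainOne G where
  toFun f := CochainOne.mk (fun e => f e.headV - f e.tailV) (coboundary_rev f)
  map_add' f g := CochainOne.ext fun e => by
    simp only [CochainOne.mk_apply, CochainOne.add_apply, Pi.add_apply]
    ring
  map_smul' c f := CochainOne.ext fun e => by
    simp only [CochainOne.mk_apply, CochainOne.smul_apply, Pi.smul_apply, smul_eq_mul,
      RingHom.id_apply]
    ring

lemma coboundary_apply (G : Graph α β) (f : V(G) → ℝ) (e : OrientedEdge G) :
    coboundary G f e = f e.headV - f e.tailV := rfl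

/-- The cut space `F_ℝ`. -/
def cutSpace (G : Graph α β) : Submodule ℝ (CochainOne G) := LinearMap.range (coboundary G)

/-- The cut lattice `F_ℤ`, inside `C¹(G, ℝ)`. -/
def cutLattice (G : Graph α β) : Set (CochainOne G) :=
  Set.range fun f : V(G) → ℤ => coboundary G fun w => (f w : ℝ)

/-- The positive support of an element of `C¹(G, ℝ)`. -/
def posSupp {G : Graph α β} (x : CochainOne G) : Set (OrientedEdge G) := {e | 0 < x e}

/-- `d(χ_C)` for a set `C` of vertices. -/
noncomputable def cutElement (G : Graph α β) (C : Set α) : CochainOne G :=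
  coboundary G (Set.indicator {w : V(G) | (w : α) ∈ C} 1)

/-- Bond elements: `d(χ_C)` where `C` and its complement both induce connected (in particular
non-empty) subgraphs. -/
def bonds (G : Graph α β) : Set (CochainOne G) :=
  {x | ∃ C ⊆ V(G), (G.induce C).toSimpleGraph.Connected ∧
    (G.induce (V(G) \ C)).toSimpleGraph.Connected ∧ x = cutElement G C}

/-- `D` is the set of oriented edges of a coherent acyclic orientation of a cut subgraph of `G`:
there is an ordered partition of the vertex set into the non-empty parts `p ⁻¹' {i}`, and `D`
consists of all edges between different parts, oriented from the smaller to the larger index. -/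
def IsCoherentAcyclic (G : Graph α β) (D : Set (OrientedEdge G)) : Prop :=
  ∃ (s : ℕ) (p : V(G) → Fin s), Function.Surjective p ∧ D = {e | p e.tailV < p e.headV}

/-- Non-empty faces of a polytope. -/
def IsFace {E : Type*} [NormedAddCommGroup E] [NormedSpace ℝ E] (P f : Set E) : Prop :=
  f.Nonempty ∧ IsExposed ℝ P f

/-- `G - E(D)`. -/
def removeEdges (G : Graph α β) (D : Set (OrientedEdge G)) : Graph α β :=
  G.deleteEdges (OrientedEdge.edge '' D)

/-- Index set of the connected components of a graph. -/
abbrev Component (G : Graph α β) := G.toSimpleGraph.ConnectedComponent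

/-- The connected component with index `c`, as a graph. -/
def componentGraph (G : Graph α β) (c : Component G) : Graph α β :=
  G.induce (Subtype.val '' c.supp)

open scoped Classical in
/-- For a subgraph `X` of `G`, the inclusion `C¹(X, ℝ) ⊆ C¹(G, ℝ)`, extending by zero. -/
noncomputable def extendByZero (X G : Graph α β) : CochainOne X →ₗ[ℝ] CochainOne G where
  toFun x := CochainOne.mk
    (fun e => if h : X.IsLink e.edge e.tail e.head then x ⟨_, _, _, h⟩ else 0) (fun e => by
      by_cases h : X.IsLink e.edge e.tail e.head
      · have h' : X.IsLink e.rev.edge e.rev.tail e.rev.head := h.symm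
        simp only [dif_pos h, dif_pos h']
        exact x.apply_rev ⟨_, _, _, h⟩
      · have h' : ¬ X.IsLink e.rev.edge e.rev.tail e.rev.head := fun k => h k.symm
        simp only [dif_neg h, dif_neg h', neg_zero])
  map_add' x y := CochainOne.ext fun e => by
    by_cases h : X.IsLink e.edge e.tail e.head <;> simp [h]
  map_smul' c x := CochainOne.ext fun e => by
    by_cases h : X.IsLink e.edge e.tail e.head <;> simp [h]

/-- The set of all sums `∑ y_i` with `y_i ∈ S_i`. -/
def minkowskiSum {ι E : Type*} [Finite ι] [AddCommMonoid E] (S : ι → Set E) : Set E :=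
  {x | ∃ y : ι → E, (∀ i, y i ∈ S i) ∧ x = ∑ᶠ i, y i}

lemma chi_rev {G : Graph α β} (D : Set (OrientedEdge G)) (e : OrientedEdge G) :
    (D.indicator 1 e.rev - D.indicator 1 e.rev.rev : ℝ) =
      -(D.indicator 1 e - D.indicator 1 e.rev) := by simp

/-- `χ_D`: it takes the value `1` on `D`, `-1` on the reverses of elements of `D`, and `0`
elsewhere (an orientation never contains an edge and its reverse). -/
noncomputable def chi {G : Graph α β} (D : Set (OrientedEdge G)) : CochainOne G :=
  CochainOne.mk (fun e => D.indicator 1 e - D.indicator 1 e.rev) (chi_rev D)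

/-- The hypercube `□_a`. -/
def cube {G : Graph α β} (a : CochainOne G) : Set (CochainOne G) :=
  {x | ∀ e, |x e - a e| ≤ 1 / 2}

section Finite

variable [Finite α] [Finite β]

/-- The Voronoi cell of `b ∈ F_ℤ` in `F_ℝ`, with respect to the lattice `F_ℤ`. -/
def vorCell (G : Graph α β) (b : CochainOne G) : Set (CochainOne G) :=
  {x | x ∈ cutSpace G ∧ ∀ m ∈ cutLattice G, ‖x - b‖ ≤ ‖x - m‖}

/-- The hyperplane `F_b = {x ∈ F_ℝ | 2⟨x, b⟩ = ‖b‖²}`. -/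
def bisector (G : Graph α β) (b : CochainOne G) : Set (CochainOne G) :=
  {x | x ∈ cutSpace G ∧ 2 * inner ℝ x b = ‖b‖ ^ 2}

/-- The map `φ` from faces of `Vor_F(O)` to orientations: the union of the positive supports of
the bond elements `b` with `f ⊆ F_b`. -/
def faceOrientation (G : Graph α β) (f : Set (CochainOne G)) : Set (OrientedEdge G) :=
  ⋃ b ∈ {b | b ∈ bonds G ∧ f ⊆ bisector G b}, posSupp b

/-- The orthogonal projection of `C¹(G, ℝ)` onto the cut space. -/
noncomputable def proj (G : Graph α β) : CochainOne G →L[ℝ] CochainOne G :=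
  (cutSpace G).starProjection

/-- The face `□_{D,0} = ½χ_D + ∑ □_{i,0}` of the cube `□_0`. -/
noncomputable def cubeFace (G : Graph α β) (D : Set (OrientedEdge G)) : Set (CochainOne G) :=
  {(1 / 2 : ℝ) • chi D} + minkowskiSum fun c : Component (removeEdges G D) =>
    extendByZero (componentGraph (removeEdges G D) c) G ''
      cube (0 : CochainOne (componentGraph (removeEdges G D) c))

/-- `∑ Vor_{F_i}(O) + ½χ_D`. -/
noncomputable def vorSum (G : Graph α β) (D : Set (OrientedEdge G)) : Set (CochainOne G) :=
  (minkowskiSum fun c : Component (removeEdges G D) =>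
    extendByZero (componentGraph (removeEdges G D) c) G ''
      vorCell (componentGraph (removeEdges G D) c) 0) + {(1 / 2 : ℝ) • chi D}

end Finite

end CutVoronoi

open CutVoronoi

/-! The Voronoi cell is a zonotope, the image under π_F of the cube `cubeOn ∅`
(`proj_image_cubeOn_empty`). Half the ℓ¹-norm is the support function of the cube. Lattice vectors
satisfy ‖m‖² ≥ ‖m‖₁, with equality for cuts, and every potential is, up to a constant, a nonnegative
combination of indicators of nested sets along which ‖d(·)‖₁ is additive. So the Voronoi
inequalities bound every functional from F by its maximum on the cube, and Hahn–Banach gives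
equality.

Functionals from F do not see π_F, so the non-empty faces of the cell are the sets π_F(`cubeOn
(posSupp w)`) with w ∈ F. Such a face lies in F_β iff supp⁺(β) ⊆ supp⁺(w), and each oriented edge of
supp⁺(w) lies in such a bond (`exists_bond_posSupp_subset`). Hence φ returns supp⁺(w), which
determines the face. A coherent acyclic D is supp⁺ of the coboundary of the part index, whence
existence and uniqueness.

The cube face in question is □_{D,0}, and linear maps commute with relative interiors of convex
sets. For the Voronoi sum, projecting each component cube to F_i first does not change its image
under π_F. Injectivity holds because cut elements y_i of the components are the restrictions of a
single d(g), and ⟨∑ y_i, d(g)⟩ = ∑ ‖y_i‖². -/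

namespace CutVoronoi

open scoped Graph Pointwise

universe u v

variable {α : Type u} {β : Type v}

/-! ### Relative interiors under linear maps -/

section RelativeInterior

variable {E F : Type*} [NormedAddCommGroup E] [NormedSpace ℝ E]
  [NormedAddCommGroup F] [NormedSpace ℝ F]

lemma exists_lineMap_mem_of_mem_intrinsicInterior {C : Set E} {x z : E}
    (hz : z ∈ intrinsicInterior ℝ C) (hx : x ∈ C) :
    ∃ t : ℝ, 1 < t ∧ AffineMap.lineMap x z t ∈ C := by
  obtain ⟨y, hy, rfl⟩ := hz
  have hxs : x ∈ affineSpan ℝ C := subset_affineSpan ℝ C hx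
  let γ : ℝ → affineSpan ℝ C := fun t =>
    ⟨AffineMap.lineMap x (y : E) t, AffineMap.lineMap_mem t hxs y.2⟩
  have hγ : Continuous γ := by
    refine Continuous.subtype_mk ?_ _
    exact AffineMap.lineMap_continuous
  have hγ1 : γ 1 = y := Subtype.ext (by simp [γ])
  have hev : ∀ᶠ t in nhds (1 : ℝ), γ t ∈ interior ((↑) ⁻¹' C : Set (affineSpan ℝ C)) := by
    refine hγ.continuousAt.eventually_mem ?_
    rw [hγ1]
    exact isOpen_interior.mem_nhds hy
  obtain ⟨t, ht, ht1⟩ := ((hev.filter_mono nhdsWithin_le_nhds).and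
    (self_mem_nhdsWithin (a := (1 : ℝ)) (s := Set.Ioi 1))).exists
  have htC : γ t ∈ ((↑) ⁻¹' C : Set (affineSpan ℝ C)) := interior_subset ht
  exact ⟨t, ht1, htC⟩

/-- The homothety with centre `y` and ratio `s` maps `C` into itself by convexity. Its inverse `h`
pulls the relative interior back to an open set inside `C`. -/
lemma lineMap_mem_intrinsicInterior {C : Set E} (hC : Convex ℝ C) {x y : E} {s : ℝ}
    (hx : x ∈ intrinsicInterior ℝ C) (hy : y ∈ C) (hs0 : 0 < s) (hs1 : s ≤ 1) :
    AffineMap.lineMap y x s ∈ intrinsicInterior ℝ C := by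
  obtain ⟨x, hx, rfl⟩ := hx
  have hys : y ∈ affineSpan ℝ C := subset_affineSpan ℝ C hy
  let h : affineSpan ℝ C → affineSpan ℝ C := fun p =>
    ⟨AffineMap.lineMap y (p : E) s⁻¹, AffineMap.lineMap_mem _ hys p.2⟩
  have hh : Continuous h := by
    refine Continuous.subtype_mk ?_ _
    simp only [AffineMap.lineMap_apply_module]
    fun_prop
  refine ⟨⟨AffineMap.lineMap y (x : E) s, AffineMap.lineMap_mem _ hys x.2⟩, ?_, rfl⟩
  refine mem_interior.mpr ⟨h ⁻¹' interior ((↑) ⁻¹' C), ?_, isOpen_interior.preimage hh, ?_⟩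
  · intro p hp
    have hpC : h p ∈ ((↑) ⁻¹' C : Set (affineSpan ℝ C)) := interior_subset hp
    have hp' : (p : E) = AffineMap.lineMap y (h p : E) s := by
      simp only [h, AffineMap.lineMap_apply_module', add_sub_cancel_right, smul_smul,
        mul_inv_cancel₀ hs0.ne', one_smul, sub_add_cancel]
    change (p : E) ∈ C
    rw [hp']
    exact hC.lineMap_mem hy hpC ⟨hs0.le, hs1⟩
  · have : h ⟨AffineMap.lineMap y (x : E) s, AffineMap.lineMap_mem _ hys x.2⟩ = x := by
      refine Subtype.ext ?_
      simp only [h, AffineMap.lineMap_apply_module', add_sub_cancel_right, smul_smul,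
        inv_mul_cancel₀ hs0.ne', one_smul, sub_add_cancel]
    rw [Set.mem_preimage, this]
    exact hx

lemma lineMap_lineMap_inv (x z : E) {t : ℝ} (ht : t ≠ 0) :
    AffineMap.lineMap (AffineMap.lineMap x z t) x (1 - t⁻¹) = z := by
  simp only [AffineMap.lineMap_apply_module']
  match_scalars <;> field_simp <;> ring

/-- Linear maps between finite-dimensional spaces commute with taking the relative interior of a
convex set. -/
theorem image_intrinsicInterior_of_convex [FiniteDimensional ℝ E] [FiniteDimensional ℝ F]
    (A : E →ₗ[ℝ] F) {C : Set E} (hC : Convex ℝ C) :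
    A '' intrinsicInterior ℝ C = intrinsicInterior ℝ (A '' C) := by
  rcases C.eq_empty_or_nonempty with rfl | hne
  · simp
  have key : ∀ t : ℝ, 1 < t → 0 < 1 - t⁻¹ ∧ 1 - t⁻¹ ≤ 1 := fun t ht =>
    ⟨by have := inv_lt_one_of_one_lt₀ ht; linarith,
      by have := inv_pos.mpr (zero_lt_one.trans ht); linarith⟩
  have hmap : ∀ (x z : E) (t : ℝ),
      A (AffineMap.lineMap x z t) = AffineMap.lineMap (A x) (A z) t := fun x z t => by
    simp [AffineMap.lineMap_apply_module]
  apply Set.Subset.antisymm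
  · rintro _ ⟨z, hz, rfl⟩
    obtain ⟨y, hy⟩ := (hne.image A).intrinsicInterior (hC.linear_image A)
    -- Prolong the segment from `x` through `z` beyond `z` within `C`: then `A z` lies between a
    -- point of the image and the relatively interior point `A x`.
    obtain ⟨x, hx, rfl⟩ := intrinsicInterior_subset hy
    obtain ⟨t, ht, htC⟩ := exists_lineMap_mem_of_mem_intrinsicInterior hz hx
    rw [← lineMap_lineMap_inv (A x) (A z) (zero_lt_one.trans ht).ne', ← hmap x z t]
    exact lineMap_mem_intrinsicInterior (hC.linear_image A) hy (Set.mem_image_of_mem A htC)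
      (key t ht).1 (key t ht).2
  · intro y hy
    obtain ⟨x, hx⟩ := hne.intrinsicInterior hC
    -- The same prolongation downstairs, from `A x` beyond `y`; its endpoint lifts to `x'`, and a
    -- point between `x'` and `x` maps to `y`.
    obtain ⟨t, ht, x', hx', hxt⟩ := exists_lineMap_mem_of_mem_intrinsicInterior hy
      (Set.mem_image_of_mem A (intrinsicInterior_subset hx))
    refine ⟨AffineMap.lineMap x' x (1 - t⁻¹),
      lineMap_mem_intrinsicInterior hC hx hx' (key t ht).1 (key t ht).2, ?_⟩
    rw [hmap, hxt, lineMap_lineMap_inv _ _ (zero_lt_one.trans ht).ne']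

end RelativeInterior

/-! ### Faces of the cube -/

variable {G : Graph α β}

/-- The face of the cube `□_0` on which the coordinates in `D` are equal to `1/2`. -/
def cubeOn (D : Set (OrientedEdge G)) : Set (CochainOne G) :=
  {x | (∀ e, |x e| ≤ 1 / 2) ∧ ∀ e ∈ D, x e = 1 / 2}

lemma mul_le_half_abs {a b : ℝ} (hb : |b| ≤ 1 / 2) : a * b ≤ |a| / 2 := by
  have h := abs_mul a b
  have h2 := le_abs_self (a * b)
  have h3 := mul_le_mul_of_nonneg_left hb (abs_nonneg a)
  linarith

lemma half_chi_mem_cubeOn {D : Set (OrientedEdge G)} (hD : ∀ e ∈ D, e.rev ∉ D) :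
    (1 / 2 : ℝ) • chi D ∈ cubeOn D := by
  classical
  refine ⟨fun e => ?_, fun e he => ?_⟩
  · simp only [chi, CochainOne.smul_apply, CochainOne.mk_apply, Set.indicator_apply, Pi.one_apply]
    split_ifs <;> norm_num
  · simp [chi, he, hD e he]

lemma rev_notMem_posSupp (w : CochainOne G) : ∀ e ∈ posSupp w, e.rev ∉ posSupp w := by
  intro e he he'
  simp only [posSupp, Set.mem_ofPred_eq, w.apply_rev] at he he'
  linarith

lemma coboundary_indicator_apply (T : Set V(G)) (e : OrientedEdge G) :
    coboundary G (T.indicator 1) e = T.indicator 1 e.headV - T.indicator 1 e.tailV := rfl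

lemma coboundary_const (c : ℝ) : coboundary G (fun _ => c) = 0 :=
  CochainOne.ext fun e => by simp [coboundary_apply]

lemma cubeOn_empty : cubeOn (∅ : Set (OrientedEdge G)) = {x | ∀ e, |x e| ≤ 1 / 2} := by
  simp [cubeOn]

lemma convex_cubeOn (D : Set (OrientedEdge G)) : Convex ℝ (cubeOn D) := by
  intro x hx y hy a b ha hb hab
  refine ⟨fun e => ?_, fun e he => ?_⟩
  · have h1 := abs_le.mp (hx.1 e)
    have h2 := abs_le.mp (hy.1 e)
    simp only [CochainOne.add_apply, CochainOne.smul_apply]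
    rw [abs_le]
    have hb' : b = 1 - a := by linarith
    subst hb'
    constructor <;> nlinarith
  · simp only [CochainOne.add_apply, CochainOne.smul_apply, hx.2 e he, hy.2 e he]
    rw [← add_mul, hab, one_mul]

lemma coboundary_indicator_mem_cutLattice (T : Set V(G)) :
    coboundary G (T.indicator 1) ∈ cutLattice G := by
  classical
  refine ⟨T.indicator 1, congrArg (coboundary G) (funext fun w => ?_)⟩
  by_cases h : w ∈ T <;> simp [h]

/-! ### The Voronoi cell as a projected cube, and its faces -/

section Finite

variable [Finite α] [Finite β]

lemma proj_mem_cutSpace (x : CochainOne G) : proj G x ∈ cutSpace G :=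
  Submodule.starProjection_apply_mem _ x

lemma inner_proj_right {w : CochainOne G} (hw : w ∈ cutSpace G) (x : CochainOne G) :
    inner ℝ w (proj G x) = inner ℝ w x := by
  have h := Submodule.sub_starProjection_mem_orthogonal (K := cutSpace G) x
  have h2 := (Submodule.mem_orthogonal _ _).mp h w hw
  rw [inner_sub_right] at h2
  exact (sub_eq_zero.mp h2).symm

/-- The `ℓ¹`-norm of a cochain, each edge being counted once. -/
noncomputable def l1Norm (x : CochainOne G) : ℝ := (∑ e : OrientedEdge G, |x e|) / 2

lemma two_inner_le_l1Norm (w : CochainOne G) {y : CochainOne G} (hy : ∀ e, |y e| ≤ 1 / 2) :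
    2 * inner ℝ w y ≤ l1Norm w := by
  have h : ∑ e, w e * y e ≤ ∑ e, |w e| / 2 :=
    Finset.sum_le_sum fun e _ => mul_le_half_abs (hy e)
  rw [← Finset.sum_div] at h
  rw [CochainOne.inner_def, l1Norm]
  linarith

lemma two_inner_eq_l1Norm_iff (w : CochainOne G) {y : CochainOne G} (hy : ∀ e, |y e| ≤ 1 / 2) :
    2 * inner ℝ w y = l1Norm w ↔ ∀ e ∈ posSupp w, y e = 1 / 2 := by
  have h := Finset.sum_eq_sum_iff_of_le (s := Finset.univ) (f := fun e => w e * y e)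
    (g := fun e => |w e| / 2) fun e _ => mul_le_half_abs (hy e)
  rw [← Finset.sum_div] at h
  have h' : 2 * inner ℝ w y = l1Norm w ↔ ∑ e, w e * y e = (∑ e, |w e|) / 2 := by
    rw [CochainOne.inner_def, l1Norm]
    constructor <;> intro h <;> linarith
  rw [h', h]
  constructor
  · intro H e he
    have := H e (Finset.mem_univ e)
    simp only [abs_of_pos (show 0 < w e from he)] at this
    have h0 : w e ≠ 0 := (show 0 < w e from he).ne'
    field_simp at this ⊢
    linarith
  · intro H e _
    rcases lt_trichotomy (w e) 0 with hw | hw | hw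
    -- Negative coordinates are governed by the reversed edge, which lies in the positive support.
    · have := H e.rev (by simp only [posSupp, Set.mem_ofPred_eq, w.apply_rev]; linarith)
      rw [y.apply_rev] at this
      rw [abs_of_neg hw, show y e = -(1 / 2) by linarith]
      ring
    · simp [hw]
    · rw [abs_of_pos hw, H e hw]
      ring

lemma norm_sq_eq_sum (m : CochainOne G) : ‖m‖ ^ 2 = (∑ e, m e * m e) / 2 := by
  rw [← real_inner_self_eq_norm_sq, CochainOne.inner_def]

lemma mem_vorCell_zero_iff {x : CochainOne G} :
    x ∈ vorCell G 0 ↔ x ∈ cutSpace G ∧ ∀ m ∈ cutLattice G, 2 * inner ℝ m x ≤ ‖m‖ ^ 2 := by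
  refine and_congr_right fun _ => forall₂_congr fun m _ => ?_
  rw [sub_zero, ← sq_le_sq₀ (norm_nonneg _) (norm_nonneg _), norm_sub_sq_real, real_inner_comm]
  constructor <;> intro h <;> linarith

/-- Integers satisfy |n| ≤ n². -/
lemma l1Norm_le_norm_sq {m : CochainOne G} (hm : m ∈ cutLattice G) : l1Norm m ≤ ‖m‖ ^ 2 := by
  obtain ⟨f, rfl⟩ := hm
  rw [norm_sq_eq_sum, l1Norm]
  refine div_le_div_of_nonneg_right (Finset.sum_le_sum fun e _ => ?_) two_pos.le
  rw [coboundary_apply]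
  generalize f e.headV = a
  generalize f e.tailV = b
  have h : |a - b| ≤ (a - b) * (a - b) := by
    rw [← abs_mul_abs_self (a - b)]
    rcases eq_or_ne (a - b) 0 with h | h
    · simp [h]
    · exact le_mul_of_one_le_left (abs_nonneg _) (Int.one_le_abs h)
  exact_mod_cast h

lemma norm_sq_coboundary_indicator (T : Set V(G)) :
    ‖coboundary G (T.indicator 1)‖ ^ 2 = l1Norm (coboundary G (T.indicator 1)) := by
  classical
  rw [norm_sq_eq_sum, l1Norm]
  congr 1
  refine Finset.sum_congr rfl fun e _ => ?_
  rw [coboundary_indicator_apply, Set.indicator_apply, Set.indicator_apply]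
  split_ifs <;> simp

/-- Layer-cake decomposition: subtracting the least positive value of `g` times the indicator of its
support keeps `g` nonnegative and shrinks the support. -/
lemma two_inner_coboundary_le_of_nonneg {x : CochainOne G}
    (hx : ∀ T : Set V(G),
      2 * inner ℝ (coboundary G (T.indicator 1)) x ≤ l1Norm (coboundary G (T.indicator 1)))
    (n : ℕ) : ∀ g : V(G) → ℝ, (∀ v, 0 ≤ g v) → (Function.support g).ncard = n →
      2 * inner ℝ (coboundary G g) x ≤ l1Norm (coboundary G g) := by
  classical
  induction n using Nat.strong_induction_on with
  | _ n ih =>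
  intro g hg hn
  rcases (Function.support g).eq_empty_or_nonempty with h0 | hne
  · have : g = 0 := Function.support_eq_empty_iff.mp h0
    simp [this, l1Norm]
  obtain ⟨a, ha, hmin⟩ := Set.exists_min_image _ g (Set.toFinite _) hne
  set T := Function.support g with hT
  have hpos : 0 < g a := lt_of_le_of_ne (hg a) (Ne.symm ha)
  set g' : V(G) → ℝ := fun v => g v - g a * T.indicator 1 v with hg'
  have hg0 : ∀ v, v ∉ T → g v = 0 := fun v hv => Function.notMem_support.mp hv
  have hg'0 : ∀ v, 0 ≤ g' v := by
    intro v
    by_cases hv : v ∈ T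
    · have := hmin v hv
      simp [hg', hv, this]
    · simp [hg', hv, hg0 v hv]
  have hsub : Function.support g' ⊂ T := by
    refine (Set.ssubset_iff_of_subset fun v hv => ?_).mpr ⟨a, ha, by simp [hg', ha]⟩
    by_contra hv'
    exact hv (by simp [hg', hv', hg0 v hv'])
  have hlt : (Function.support g').ncard < n := hn ▸ Set.ncard_lt_ncard hsub (Set.toFinite _)
  have ih' := ih _ hlt g' hg'0 rfl
  have hsplit : coboundary G g = g a • coboundary G (T.indicator 1) + coboundary G g' := by
    rw [← map_smul, ← map_add]
    congr 1
    funext v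
    simp [hg']
  -- No cancellation: across each edge the differences of the two summands never have opposite
  -- signs.
  have hl1 : l1Norm (coboundary G g) =
      g a * l1Norm (coboundary G (T.indicator 1)) + l1Norm (coboundary G g') := by
    simp only [l1Norm]
    rw [← mul_div_assoc, Finset.mul_sum, ← add_div, ← Finset.sum_add_distrib]
    congr 1
    refine Finset.sum_congr rfl fun e _ => ?_
    rw [coboundary_indicator_apply, coboundary_apply, coboundary_apply]
    have h1 := hg'0 e.headV
    have h2 := hg'0 e.tailV
    by_cases hh : e.headV ∈ T <;> by_cases ht : e.tailV ∈ T
    · simp [hg', hh, ht]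
    · simp only [hg', hh, ht, hg0 _ ht, Set.indicator_of_mem, Set.indicator_of_notMem,
        not_false_eq_true, Pi.one_apply, mul_one, mul_zero, sub_zero, abs_one] at h1 ⊢
      rw [abs_of_nonneg h1, abs_of_nonneg (hg _)]
      ring
    · simp only [hg', hh, ht, hg0 _ hh, Set.indicator_of_mem, Set.indicator_of_notMem,
        not_false_eq_true, Pi.one_apply, mul_one, mul_zero, sub_zero, zero_sub, abs_neg,
        abs_one] at h2 ⊢
      rw [abs_of_nonneg h2, abs_of_nonneg (hg _)]
      ring
    · simp [hg', hh, ht, hg0 _ hh, hg0 _ ht]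
  rw [hl1, hsplit, inner_add_left, inner_smul_left]
  have := mul_le_mul_of_nonneg_left (hx T) hpos.le
  simp only [conj_trivial]
  linarith

/-- The inequalities given by the cuts imply the inequalities given by all elements of the cut
space. -/
lemma two_inner_coboundary_le {x : CochainOne G}
    (hx : ∀ T : Set V(G),
      2 * inner ℝ (coboundary G (T.indicator 1)) x ≤ l1Norm (coboundary G (T.indicator 1)))
    (g : V(G) → ℝ) : 2 * inner ℝ (coboundary G g) x ≤ l1Norm (coboundary G g) := by
  -- Constants have zero coboundary, so `g` may be shifted to be nonnegative.
  obtain ⟨c, hc⟩ := (Set.finite_range g).bddBelow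
  have h := two_inner_coboundary_le_of_nonneg hx _ (g - fun _ => c)
    (fun v => sub_nonneg.mpr (hc ⟨v, rfl⟩)) rfl
  rwa [map_sub, coboundary_const, sub_zero] at h

lemma continuous_apply_edge (e : OrientedEdge G) : Continuous fun x : CochainOne G => x e := by
  let l : CochainOne G →ₗ[ℝ] ℝ :=
    { toFun := fun x => x e, map_add' := fun _ _ => rfl, map_smul' := fun _ _ => rfl }
  exact l.continuous_of_finiteDimensional

lemma isCompact_cubeOn (D : Set (OrientedEdge G)) : IsCompact (cubeOn D) := by
  refine Metric.isCompact_of_isClosed_isBounded ?_ ?_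
  · have h : cubeOn D = (⋂ e, {x : CochainOne G | |x e| ≤ 1 / 2}) ∩
        ⋂ e ∈ D, {x : CochainOne G | x e = 1 / 2} := by
      ext x
      simp [cubeOn]
    rw [h]
    exact (isClosed_iInter fun e =>
      isClosed_le (continuous_apply_edge e).abs continuous_const).inter
      (isClosed_biInter fun e _ => isClosed_eq (continuous_apply_edge e) continuous_const)
  · refine (isBounded_iff_forall_norm_le).mpr
      ⟨Real.sqrt ((∑ _e : OrientedEdge G, (1 : ℝ)) / 2), fun x hx => Real.le_sqrt_of_sq_le ?_⟩
    rw [norm_sq_eq_sum]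
    refine div_le_div_of_nonneg_right (Finset.sum_le_sum fun e _ => ?_) two_pos.le
    have h1 := abs_le.mp (hx.1 e)
    nlinarith

/-- The Voronoi cell of the cut lattice is the projection of the cube. -/
theorem proj_image_cubeOn_empty : proj G '' cubeOn ∅ = vorCell G 0 := by
  apply Set.Subset.antisymm
  · rintro _ ⟨y, hy, rfl⟩
    refine mem_vorCell_zero_iff.mpr ⟨proj_mem_cutSpace y, fun m hm => ?_⟩
    have hm' : m ∈ cutSpace G := by
      obtain ⟨f, rfl⟩ := hm
      exact ⟨_, rfl⟩
    rw [inner_proj_right hm']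
    exact (two_inner_le_l1Norm m hy.1).trans (l1Norm_le_norm_sq hm)
  · intro x hx
    rw [mem_vorCell_zero_iff] at hx
    by_contra hxn
    obtain ⟨l, c, hl1, hl2⟩ := geometric_hahn_banach_closed_point
      ((convex_cubeOn (∅ : Set (OrientedEdge G))).linear_image (proj G).toLinearMap)
      ((isCompact_cubeOn (∅ : Set (OrientedEdge G))).image (proj G).continuous).isClosed hxn
    -- The separating functional is represented on the cut space by the projection of its Riesz
    -- vector.
    set w := proj G ((InnerProductSpace.toDual ℝ (CochainOne G)).symm l) with hw
    have hwF : w ∈ cutSpace G := proj_mem_cutSpace _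
    have hlw : ∀ y ∈ cutSpace G, l y = inner ℝ w y := fun y hy => by
      rw [real_inner_comm, hw, inner_proj_right hy, real_inner_comm,
        InnerProductSpace.toDual_symm_apply]
    obtain ⟨g, hg⟩ := hwF
    have hcut : 2 * inner ℝ w x ≤ l1Norm w := by
      rw [← hg]
      refine two_inner_coboundary_le (fun T => ?_) g
      rw [← norm_sq_coboundary_indicator]
      exact hx.2 _ (coboundary_indicator_mem_cutLattice T)
    -- This vertex or face centre of the cube attains half the ℓ¹-norm of `w`, a bound that `x`
    -- obeys, so `w` cannot separate `x`.
    have hy := half_chi_mem_cubeOn (rev_notMem_posSupp w)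
    have h1 := hl1 _ (Set.mem_image_of_mem _
      (show (1 / 2 : ℝ) • chi (posSupp w) ∈ cubeOn ∅ by rw [cubeOn_empty]; exact hy.1))
    have h2 : l (proj G ((1 / 2 : ℝ) • chi (posSupp w))) =
        inner ℝ w ((1 / 2 : ℝ) • chi (posSupp w)) := by
      rw [hlw _ (proj_mem_cutSpace _), inner_proj_right ⟨g, hg⟩]
    have h3 := (two_inner_eq_l1Norm_iff w hy.1).mpr hy.2
    rw [hlw x hx.1] at hl2
    have h1' : l (proj G ((1 / 2 : ℝ) • chi (posSupp w))) < c := h1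
    linarith

/-- A functional from the cut space takes equal values at `y` and at its projection, so its
maximizers on the cell are the images of its maximizers on the cube. -/
lemma setOf_maximizer_eq_proj_image {w : CochainOne G} (hw : w ∈ cutSpace G) :
    {x ∈ vorCell G 0 | ∀ y ∈ vorCell G 0, inner ℝ w y ≤ inner ℝ w x} =
      proj G '' cubeOn (posSupp w) := by
  have hchi := half_chi_mem_cubeOn (rev_notMem_posSupp w)
  rw [← proj_image_cubeOn_empty, cubeOn_empty]
  ext x
  constructor
  · rintro ⟨⟨y, hy, rfl⟩, hmax⟩
    refine ⟨y, ⟨hy, ?_⟩, rfl⟩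
    have h := hmax _ ⟨_, hchi.1, rfl⟩
    rw [inner_proj_right hw, inner_proj_right hw] at h
    have h2 := (two_inner_eq_l1Norm_iff w hchi.1).mpr hchi.2
    have h3 := two_inner_le_l1Norm w hy
    exact (two_inner_eq_l1Norm_iff w hy).mp (by linarith)
  · rintro ⟨y, hy, rfl⟩
    refine ⟨⟨y, hy.1, rfl⟩, ?_⟩
    rintro _ ⟨z, hz, rfl⟩
    rw [inner_proj_right hw, inner_proj_right hw]
    have h2 := (two_inner_eq_l1Norm_iff w hy.1).mpr hy.2
    have h3 := two_inner_le_l1Norm w hz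
    linarith

/-- Every non-empty face of the Voronoi cell is the projection of a face of the cube. -/
theorem exists_of_isFace {f : Set (CochainOne G)} (hf : IsFace (vorCell G 0) f) :
    ∃ w ∈ cutSpace G, f = proj G '' cubeOn (posSupp w) := by
  obtain ⟨l, hl⟩ := hf.2 hf.1
  set w := proj G ((InnerProductSpace.toDual ℝ (CochainOne G)).symm l) with hw
  have hlw : ∀ y ∈ vorCell G 0, l y = inner ℝ w y := fun y hy => by
    rw [real_inner_comm, hw, inner_proj_right hy.1, real_inner_comm,
      InnerProductSpace.toDual_symm_apply]
  refine ⟨w, proj_mem_cutSpace _, ?_⟩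
  rw [← setOf_maximizer_eq_proj_image (proj_mem_cutSpace _), hl]
  ext x
  refine and_congr_right fun hx => forall₂_congr fun y hy => ?_
  rw [hlw x hx, hlw y hy]

theorem isFace_proj_image_cubeOn {w : CochainOne G} (hw : w ∈ cutSpace G) :
    IsFace (vorCell G 0) (proj G '' cubeOn (posSupp w)) := by
  refine ⟨⟨_, _, half_chi_mem_cubeOn (rev_notMem_posSupp w), rfl⟩, fun _ =>
    ⟨InnerProductSpace.toDual ℝ (CochainOne G) w, ?_⟩⟩
  rw [← setOf_maximizer_eq_proj_image hw]
  rfl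

end Finite

/-! ### Bonds inside cuts -/

/-- The spanning subgraph of the simple graph `S` whose edges are those inside `T`. -/
def edgesInside {V : Type*} (S : SimpleGraph V) (T : Set V) : SimpleGraph V where
  Adj a b := S.Adj a b ∧ a ∈ T ∧ b ∈ T
  symm := ⟨fun _ _ h => ⟨h.1.symm, h.2.2, h.2.1⟩⟩
  loopless := ⟨fun _ h => S.irrefl h.1⟩

lemma mem_of_reachable_edgesInside {V : Type*} {S : SimpleGraph V} {T : Set V} {a b : V}
    (h : (edgesInside S T).Reachable a b) (ha : a ∈ T) : b ∈ T := by
  obtain ⟨p⟩ := h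
  induction p with
  | nil => exact ha
  | cons hab _ ih => exact ih hab.2.2

/-- In a connected graph, a cut separating two vertices `u` and `v` contains a bond that
separates them. -/
lemma exists_bond_inside_cut {V : Type*} {S : SimpleGraph V} (hS : S.Connected) {T : Set V}
    {u v : V} (hv : v ∈ T) (hu : u ∉ T) :
    ∃ C : Set V, v ∈ C ∧ u ∉ C ∧
      (∀ x ∈ C, (edgesInside S C).Reachable x v) ∧
      (∀ x ∈ Cᶜ, (edgesInside S Cᶜ).Reachable x u) ∧
      ∀ a ∉ C, ∀ b ∈ C, S.Adj a b → a ∉ T ∧ b ∈ T := by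
  -- `C₁` is the component of `v` in `T`, and `K` below that of `u` outside `C₁`. The bond is the
  -- one between `K` and its complement.
  set C₁ : Set V := {x | (edgesInside S T).Reachable x v} with hC₁
  have hC₁T : C₁ ⊆ T := fun x hx => mem_of_reachable_edgesInside (SimpleGraph.Reachable.symm hx) hv
  set K : Set V := {x | (edgesInside S C₁ᶜ).Reachable x u} with hK
  have huC₁ : u ∈ C₁ᶜ := fun h => hu (hC₁T h)
  have hKC₁ : K ⊆ C₁ᶜ := fun x hx =>
    mem_of_reachable_edgesInside (SimpleGraph.Reachable.symm hx) huC₁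
  have hC₁K : C₁ ⊆ Kᶜ := fun x hx hxK => hKC₁ hxK hx
  have hvC₁ : v ∈ C₁ := SimpleGraph.Reachable.refl _
  have huK : u ∈ K := SimpleGraph.Reachable.refl _
  have hcross : ∀ a ∈ K, ∀ b ∉ K, S.Adj a b → b ∈ C₁ := by
    intro a ha b hb hab
    by_contra hbC
    refine hb (SimpleGraph.Reachable.trans ?_ ha)
    exact SimpleGraph.Adj.reachable (G := edgesInside S C₁ᶜ) ⟨hab.symm, hbC, hKC₁ ha⟩
  -- A walk to `w` inside `D` never leaves the component of `w`, so it survives in every set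
  -- containing that component.
  have hreach : ∀ {D : Set V} {w : V} {x : V},
      (edgesInside S D).Reachable x w → ∀ D', {y | (edgesInside S D).Reachable y w} ⊆ D' →
        (edgesInside S D').Reachable x w := by
    intro D w x h D' hD'
    obtain ⟨p⟩ := h
    induction p with
    | nil => exact SimpleGraph.Reachable.refl _
    | cons hab q ih =>
      refine SimpleGraph.Reachable.trans ?_ (ih hD')
      exact SimpleGraph.Adj.reachable (G := edgesInside S D')
        ⟨hab.1, hD' (hab.reachable.trans ⟨q⟩), hD' ⟨q⟩⟩
  -- Follow a walk towards `C₁`: a vertex from which it would step into `K` already lies in `C₁`, by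
  -- `hcross`.
  have hwalk : ∀ {x y : V}, S.Walk x y → y ∈ C₁ → x ∉ K → (edgesInside S Kᶜ).Reachable x v := by
    intro x y p hy hx
    induction p with
    | nil => exact hreach hy _ hC₁K
    | @cons a b c hab q ih =>
      by_cases hb : b ∈ K
      · exact hreach (hcross b hb a hx hab.symm) _ hC₁K
      · refine SimpleGraph.Reachable.trans ?_ (ih hy hb)
        exact SimpleGraph.Adj.reachable (G := edgesInside S Kᶜ) ⟨hab, hx, hb⟩
  refine ⟨Kᶜ, hC₁K hvC₁, not_not.mpr huK, fun x hx => ?_, fun x hx => ?_, ?_⟩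
  · obtain ⟨p⟩ := hS.preconnected x v
    exact hwalk p hvC₁ hx
  · rw [compl_compl] at hx ⊢
    exact hreach hx _ subset_rfl
  · intro a ha b hb hab
    have haK : a ∈ K := not_not.mp ha
    have hbC := hcross a haK b hb hab
    -- If `a` were in `T`, its neighbour `b` in `C₁` would pull it into `C₁`.
    refine ⟨fun haT => hKC₁ haK ?_, hC₁T hbC⟩
    refine SimpleGraph.Reachable.trans ?_ hbC
    exact SimpleGraph.Adj.reachable (G := edgesInside S T) ⟨hab, haT, hC₁T hbC⟩

lemma connected_induce_of_reachable {T : Set V(G)} {v : V(G)} (hv : v ∈ T)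
    (h : ∀ x ∈ T, (edgesInside G.toSimpleGraph T).Reachable x v) :
    (G.induce (Subtype.val '' T)).toSimpleGraph.Connected := by
  rw [SimpleGraph.connected_iff_exists_forall_reachable]
  refine ⟨⟨v, v, hv, rfl⟩, ?_⟩
  rintro ⟨_, x, hx, rfl⟩
  refine SimpleGraph.Reachable.symm ?_
  obtain ⟨p⟩ := h x hx
  induction p with
  | nil => exact SimpleGraph.Reachable.refl _
  | @cons a b c hab q ih =>
    refine SimpleGraph.Reachable.trans ?_ (ih hv (fun x hx => h x hx) hab.2.2)
    obtain ⟨⟨hne, e, he⟩, ha, hb⟩ := hab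
    refine SimpleGraph.Adj.reachable ⟨fun h => hne (Subtype.ext (Subtype.mk.inj h)), e, ?_⟩
    exact ⟨he, ⟨a, ha, rfl⟩, ⟨b, hb, rfl⟩⟩

lemma cutElement_image (T : Set V(G)) :
    cutElement G (Subtype.val '' T) = coboundary G (T.indicator 1) := by
  rw [cutElement]
  congr 2
  ext w
  simp

lemma mem_posSupp_coboundary_indicator {T : Set V(G)} {e : OrientedEdge G} :
    e ∈ posSupp (coboundary G (T.indicator 1)) ↔ e.tailV ∉ T ∧ e.headV ∈ T := by
  classical
  change 0 < coboundary G (T.indicator 1) e ↔ _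
  rw [coboundary_indicator_apply, Set.indicator_apply, Set.indicator_apply]
  split_ifs with h1 h2 h2 <;> simp [h1, h2]

/-- Every oriented edge in the positive support of an element of the cut space lies in the
positive support of a bond element supported there. -/
theorem exists_bond_posSupp_subset (hG : G.toSimpleGraph.Connected) {w : CochainOne G}
    (hw : w ∈ cutSpace G) {e : OrientedEdge G} (he : e ∈ posSupp w) :
    ∃ b ∈ bonds G, e ∈ posSupp b ∧ posSupp b ⊆ posSupp w := by
  obtain ⟨g, rfl⟩ := hw
  have hpos : ∀ e', e' ∈ posSupp (coboundary G g) ↔ g e'.tailV < g e'.headV := fun e' => by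
    change 0 < coboundary G g e' ↔ _
    rw [coboundary_apply, sub_pos]
  have hlt := (hpos e).mp he
  -- The cut is a superlevel set of the potential, so every edge entering it increases `g`.
  obtain ⟨C, hvC, huC, hC, hC', hcut⟩ := exists_bond_inside_cut hG
    (T := {x | g e.headV ≤ g x}) (u := e.tailV) (v := e.headV)
    (show g e.headV ≤ g e.headV from le_rfl) (not_le.mpr hlt)
  refine ⟨_, ⟨Subtype.val '' C, ?_, connected_induce_of_reachable hvC hC, ?_, rfl⟩, ?_, ?_⟩
  · rintro _ ⟨x, _, rfl⟩
    exact x.2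
  · have h : V(G) \ Subtype.val '' C = Subtype.val '' Cᶜ := by
      rw [Set.image_compl_eq_range_sdiff_image Subtype.val_injective, Subtype.range_coe]
    rw [h]
    exact connected_induce_of_reachable huC hC'
  · rw [cutElement_image, mem_posSupp_coboundary_indicator]
    exact ⟨huC, hvC⟩
  · intro e' he'
    rw [cutElement_image, mem_posSupp_coboundary_indicator] at he'
    have hne : e'.tailV ≠ e'.headV := fun h => he'.1 (h ▸ he'.2)
    obtain ⟨h1, h2⟩ := hcut _ he'.1 _ he'.2 ⟨hne, e'.edge, e'.isLink⟩
    exact (hpos e').mpr ((not_le.mp h1).trans_le h2)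

lemma bonds_eq_coboundary_indicator {b : CochainOne G} (hb : b ∈ bonds G) :
    ∃ T : Set V(G), b = coboundary G (T.indicator 1) := by
  obtain ⟨C, -, -, -, rfl⟩ := hb
  exact ⟨_, rfl⟩

/-! ### The orientation attached to a face -/

section Finite

variable [Finite α] [Finite β]

/-- For a bond, ‖b‖² is the ℓ¹-norm, so the bisector is the equality case of the cube inequality.
Necessity is tested at ½χ_D, whose coordinates outside `D` are at most 0. -/
lemma proj_image_cubeOn_subset_bisector_iff {D : Set (OrientedEdge G)}
    (hD : ∀ e ∈ D, e.rev ∉ D) {b : CochainOne G} (hb : b ∈ bonds G) :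
    proj G '' cubeOn D ⊆ bisector G b ↔ posSupp b ⊆ D := by
  obtain ⟨T, rfl⟩ := bonds_eq_coboundary_indicator hb
  set b := coboundary G (T.indicator 1) with hb'
  have hbF : b ∈ cutSpace G := ⟨_, rfl⟩
  have key : ∀ y ∈ cubeOn D, proj G y ∈ bisector G b ↔ ∀ e ∈ posSupp b, y e = 1 / 2 := by
    intro y hy
    rw [← two_inner_eq_l1Norm_iff b hy.1, ← norm_sq_coboundary_indicator]
    change _ ∧ _ ↔ _
    rw [and_iff_right (proj_mem_cutSpace y), real_inner_comm, inner_proj_right hbF]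
  constructor
  · intro h e he
    have h1 := (key _ (half_chi_mem_cubeOn hD)).mp
      (h (Set.mem_image_of_mem _ (half_chi_mem_cubeOn hD))) e he
    by_contra heD
    have h2 : (D.indicator 1 e : ℝ) = 0 := Set.indicator_of_notMem heD _
    have h3 : (0 : ℝ) ≤ D.indicator 1 e.rev := Set.indicator_nonneg (fun _ _ => zero_le_one) _
    simp only [chi, CochainOne.smul_apply, CochainOne.mk_apply, h2] at h1
    linarith
  · rintro h _ ⟨y, hy, rfl⟩
    exact (key y hy).mpr fun e he => hy.2 e (h he)

theorem faceOrientation_proj_image_cubeOn (hG : G.toSimpleGraph.Connected) {w : CochainOne G}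
    (hw : w ∈ cutSpace G) : faceOrientation G (proj G '' cubeOn (posSupp w)) = posSupp w := by
  ext e
  simp only [faceOrientation, Set.mem_iUnion, exists_prop]
  constructor
  · rintro ⟨b, ⟨hb, hsub⟩, he⟩
    exact (proj_image_cubeOn_subset_bisector_iff (rev_notMem_posSupp w) hb).mp hsub he
  · intro he
    obtain ⟨b, hb, heb, hsub⟩ := exists_bond_posSupp_subset hG hw he
    exact ⟨b, ⟨hb, (proj_image_cubeOn_subset_bisector_iff (rev_notMem_posSupp w) hb).mpr hsub⟩,
      heb⟩

end Finite

/-- The index of the part serves as potential. -/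
lemma IsCoherentAcyclic.exists_posSupp_eq {D : Set (OrientedEdge G)}
    (hD : IsCoherentAcyclic G D) : ∃ w ∈ cutSpace G, posSupp w = D := by
  obtain ⟨s, p, -, rfl⟩ := hD
  refine ⟨coboundary G fun v => ((p v : ℕ) : ℝ), ⟨_, rfl⟩, ?_⟩
  ext e
  change 0 < coboundary G (fun v => ((p v : ℕ) : ℝ)) e ↔ p e.tailV < p e.headV
  rw [coboundary_apply, sub_pos, Nat.cast_lt, Fin.val_fin_lt]

/-! ### Extension and restriction of cochains -/

section Subgraph

variable {X : Graph α β}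

/-- An oriented edge of a subgraph, as an oriented edge of the ambient graph. -/
def OrientedEdge.ofLE (h : X ≤ G) (e : OrientedEdge X) : OrientedEdge G :=
  ⟨e.edge, e.tail, e.head, e.isLink.mono h⟩

/-- Restriction of a cochain to a subgraph. -/
def restrictTo (h : X ≤ G) (x : CochainOne G) : CochainOne X :=
  CochainOne.mk (fun e => x (e.ofLE h)) fun e => x.apply_rev (e.ofLE h)

lemma restrictTo_coboundary (h : X ≤ G) (f : V(G) → ℝ) :
    restrictTo h (coboundary G f) = coboundary X fun v => f ⟨v, h.vertexSet_mono v.2⟩ := rfl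

lemma extendByZero_apply_of_isLink (x : CochainOne X) {e : OrientedEdge G}
    (he : X.IsLink e.edge e.tail e.head) : extendByZero X G x e = x ⟨_, _, _, he⟩ :=
  dif_pos he

lemma extendByZero_apply_of_not_isLink (x : CochainOne X) {e : OrientedEdge G}
    (he : ¬ X.IsLink e.edge e.tail e.head) : extendByZero X G x e = 0 :=
  dif_neg he

lemma inner_extendByZero [Finite α] [Finite β] (h : X ≤ G) (x : CochainOne X)
    (y : CochainOne G) : inner ℝ (extendByZero X G x) y = inner ℝ x (restrictTo h y) := by
  classical
  rw [CochainOne.inner_def, CochainOne.inner_def]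
  congr 1
  have hinj : Function.Injective (OrientedEdge.ofLE h) := fun a b hab => by
    have h1 := congrArg OrientedEdge.edge hab
    have h2 := congrArg OrientedEdge.tail hab
    have h3 := congrArg OrientedEdge.head hab
    exact OrientedEdge.ext h1 h2 h3
  rw [← Finset.sum_subset (Finset.subset_univ (Finset.univ.map ⟨_, hinj⟩)), Finset.sum_map]
  · refine Finset.sum_congr rfl fun e _ => ?_
    change extendByZero X G x (e.ofLE h) * y (e.ofLE h) = _
    rw [extendByZero_apply_of_isLink x (e := e.ofLE h) e.isLink]
    rfl
  · intro e _ he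
    rw [extendByZero_apply_of_not_isLink, zero_mul]
    intro hl
    exact he (Finset.mem_map.mpr ⟨⟨_, _, _, hl⟩, Finset.mem_univ _, rfl⟩)

/-- Replacing a cochain on a subgraph by its projection to the cut space of the subgraph does not
change the projection to the cut space of the ambient graph. -/
lemma proj_extendByZero_proj [Finite α] [Finite β] (h : X ≤ G) (x : CochainOne X) :
    proj G (extendByZero X G (proj X x)) = proj G (extendByZero X G x) := by
  rw [← sub_eq_zero, ← map_sub, ← map_sub]
  -- Extension by zero is adjoint to restriction, and restriction sends coboundaries to
  -- coboundaries; hence it suffices that `proj X x - x` is orthogonal to the cut space of `X`.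
  refine (Submodule.starProjection_apply_eq_zero_iff _).mpr ?_
  rw [Submodule.mem_orthogonal]
  rintro _ ⟨f, rfl⟩
  rw [real_inner_comm, inner_extendByZero h, restrictTo_coboundary, inner_sub_left, sub_eq_zero,
    real_inner_comm, real_inner_comm _ x]
  exact inner_proj_right ⟨_, rfl⟩ x

end Subgraph

/-! ### Components of G - E(D) -/

section Components

variable (D : Set (OrientedEdge G))

lemma componentGraph_le (c : Component (removeEdges G D)) :
    componentGraph (removeEdges G D) c ≤ G := by
  refine le_trans (Graph.induce_le ?_) Graph.deleteEdges_le
  rintro _ ⟨x, _, rfl⟩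
  exact x.2

/-- The component of `G - E(D)` containing a given vertex. -/
def componentOf (v : V(G)) : Component (removeEdges G D) :=
  (removeEdges G D).toSimpleGraph.connectedComponentMk v

variable {D}

lemma edge_mem_image_iff {e : OrientedEdge G} :
    e.edge ∈ OrientedEdge.edge '' D ↔ e ∈ D ∨ e.rev ∈ D := by
  constructor
  · rintro ⟨e', he', h⟩
    have hl := e'.isLink
    rw [h] at hl
    rcases e.isLink.eq_and_eq_or_eq_and_eq hl with ⟨h1, h2⟩ | ⟨h1, h2⟩
    · exact Or.inl ((OrientedEdge.ext h.symm h1 h2 : e = e') ▸ he')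
    · exact Or.inr ((OrientedEdge.ext h.symm h2 h1 : e.rev = e') ▸ he')
  · rintro (h | h)
    · exact ⟨_, h, rfl⟩
    · exact ⟨_, h, rfl⟩

lemma componentGraph_isLink_iff {c : Component (removeEdges G D)} {e : OrientedEdge G} :
    (componentGraph (removeEdges G D) c).IsLink e.edge e.tail e.head ↔
      (e ∉ D ∧ e.rev ∉ D) ∧ c = componentOf D e.tailV := by
  have hH : (removeEdges G D).IsLink e.edge e.tail e.head ↔ e ∉ D ∧ e.rev ∉ D := by
    rw [← not_or, ← edge_mem_image_iff]
    exact and_iff_right e.isLink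
  have hmem : ∀ v : V(G), (v : α) ∈ Subtype.val '' c.supp ↔ c = componentOf D v := by
    intro v
    rw [eq_comm]
    constructor
    · rintro ⟨x, hx, hxv⟩
      exact (Subtype.ext hxv : x = v) ▸ hx
    · intro h
      exact ⟨v, h, rfl⟩
  constructor
  · rintro ⟨h1, h2, -⟩
    exact ⟨hH.mp h1, (hmem e.tailV).mp h2⟩
  · rintro ⟨h1, h2⟩
    refine ⟨hH.mpr h1, (hmem e.tailV).mpr h2, (hmem e.headV).mpr (h2.trans ?_)⟩
    -- A loop gives no adjacency in the associated simple graph.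
    by_cases hne : e.tailV = e.headV
    · rw [hne]
    · exact SimpleGraph.ConnectedComponent.connectedComponentMk_eq_of_adj
        ⟨hne, e.edge, hH.mpr h1⟩

/-- Each vertex lies in exactly one component, so the potentials glue; edges of `D` impose no
condition. -/
lemma exists_coboundary_restrictTo_eq
    (y : (c : Component (removeEdges G D)) → CochainOne (componentGraph (removeEdges G D) c))
    (hy : ∀ c, y c ∈ cutSpace (componentGraph (removeEdges G D) c)) :
    ∃ g : V(G) → ℝ, ∀ c, restrictTo (componentGraph_le D c) (coboundary G g) = y c := by
  choose g hg using hy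
  refine ⟨fun v => g (componentOf D v) ⟨v, v, rfl, rfl⟩, fun c => ?_⟩
  rw [restrictTo_coboundary, ← hg c]
  refine congrArg _ (funext fun v => ?_)
  obtain ⟨_, x, hx, rfl⟩ := v
  have hx' : componentOf D x = c := hx
  subst hx'
  rfl

end Components

lemma val_sum {ι : Type*} (s : Finset ι) (x : ι → CochainOne G) (e : OrientedEdge G) :
    (∑ i ∈ s, x i) e = ∑ i ∈ s, x i e := by
  classical
  induction s using Finset.induction_on with
  | empty => simp
  | insert a s ha ih => rw [Finset.sum_insert ha, Finset.sum_insert ha, CochainOne.add_apply, ih]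

/-! ### Sums over the components -/

section Finite

variable [Finite α] (D : Set (OrientedEdge G))

noncomputable instance : Fintype (Component (removeEdges G D)) := by
  haveI : Finite V(removeEdges G D) := inferInstance
  haveI : Finite (Component (removeEdges G D)) := inferInstance
  exact Fintype.ofFinite _

/-- The sum of the extensions by zero, over all components of `G - E(D)`. -/
noncomputable def sumExtend :
    ((c : Component (removeEdges G D)) → CochainOne (componentGraph (removeEdges G D) c)) →ₗ[ℝ]
      CochainOne G :=
  ∑ c, extendByZero (componentGraph (removeEdges G D) c) G ∘ₗ LinearMap.proj c

lemma sumExtend_apply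
    (y : (c : Component (removeEdges G D)) → CochainOne (componentGraph (removeEdges G D) c)) :
    sumExtend D y = ∑ c, extendByZero (componentGraph (removeEdges G D) c) G (y c) := by
  simp [sumExtend]

lemma minkowskiSum_eq_image
    (S : (c : Component (removeEdges G D)) → Set (CochainOne (componentGraph (removeEdges G D) c))) :
    minkowskiSum (fun c => extendByZero (componentGraph (removeEdges G D) c) G '' S c) =
      sumExtend D '' Set.univ.pi S := by
  ext x
  constructor
  · rintro ⟨y, hy, rfl⟩
    choose z hz hzy using hy
    refine ⟨z, fun c _ => hz c, ?_⟩
    rw [sumExtend_apply, finsum_eq_sum_of_fintype]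
    exact Finset.sum_congr rfl fun c _ => hzy c
  · rintro ⟨z, hz, rfl⟩
    refine ⟨fun c => extendByZero _ G (z c), fun c => ⟨z c, hz c (Set.mem_univ c), rfl⟩, ?_⟩
    rw [sumExtend_apply, finsum_eq_sum_of_fintype]

variable {D}

lemma sumExtend_apply_of_mem
    (y : (c : Component (removeEdges G D)) → CochainOne (componentGraph (removeEdges G D) c))
    {e : OrientedEdge G} (he : e ∈ D ∨ e.rev ∈ D) : sumExtend D y e = 0 := by
  rw [sumExtend_apply, val_sum]
  refine Finset.sum_eq_zero fun c _ => extendByZero_apply_of_not_isLink _ fun h => ?_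
  have := (componentGraph_isLink_iff.mp h).1
  tauto

lemma sumExtend_apply_of_notMem
    (y : (c : Component (removeEdges G D)) → CochainOne (componentGraph (removeEdges G D) c))
    {e : OrientedEdge G} (he : e ∉ D) (he' : e.rev ∉ D) :
    sumExtend D y e =
      y (componentOf D e.tailV) ⟨_, _, _, componentGraph_isLink_iff.mpr ⟨⟨he, he'⟩, rfl⟩⟩ := by
  rw [sumExtend_apply, val_sum, Finset.sum_eq_single (componentOf D e.tailV)]
  · exact extendByZero_apply_of_isLink _ _
  · intro c _ hc
    exact extendByZero_apply_of_not_isLink _ fun h => hc (componentGraph_isLink_iff.mp h).2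
  · intro h
    exact absurd (Finset.mem_univ _) h

/-- The term ½χ_D fixes the coordinates on `D` and its reverses. Every other edge lies in exactly
one component, where its coordinate is free. -/
theorem cubeFace_eq_cubeOn (hD : ∀ e ∈ D, e.rev ∉ D) : cubeFace G D = cubeOn D := by
  classical
  rw [cubeFace, minkowskiSum_eq_image, Set.singleton_add]
  ext x
  have hchi0 : ∀ e, e ∉ D → e.rev ∉ D → ((1 / 2 : ℝ) • chi D) e = 0 := fun e h h' => by
    simp [chi, h, h']
  constructor
  · rintro ⟨_, ⟨y, hy, rfl⟩, rfl⟩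
    have hmem := half_chi_mem_cubeOn hD
    refine ⟨fun e => ?_, fun e he => ?_⟩
    · rw [CochainOne.add_apply]
      by_cases he : e ∈ D ∨ e.rev ∈ D
      · rw [sumExtend_apply_of_mem y he, add_zero]
        exact hmem.1 e
      · rw [not_or] at he
        rw [hchi0 e he.1 he.2, zero_add, sumExtend_apply_of_notMem y he.1 he.2]
        simpa using hy (componentOf D e.tailV) (Set.mem_univ _)
          ⟨_, _, _, componentGraph_isLink_iff.mpr ⟨he, rfl⟩⟩
    · rw [CochainOne.add_apply, sumExtend_apply_of_mem y (Or.inl he), add_zero]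
      exact hmem.2 e he
  · intro hx
    refine ⟨_, ⟨fun c => restrictTo (componentGraph_le D c) x, fun c _ e => ?_, rfl⟩, ?_⟩
    · change |x (e.ofLE (componentGraph_le D c)) - 0| ≤ 1 / 2
      rw [sub_zero]
      exact hx.1 _
    · ext e
      rw [CochainOne.add_apply]
      by_cases he : e ∈ D
      · rw [sumExtend_apply_of_mem _ (Or.inl he), add_zero, hx.2 e he]
        exact (half_chi_mem_cubeOn hD).2 e he
      by_cases he' : e.rev ∈ D
      · rw [sumExtend_apply_of_mem _ (Or.inr he'), add_zero]
        have h1 := hx.2 _ he'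
        have h2 := (half_chi_mem_cubeOn hD).2 _ he'
        rw [CochainOne.apply_rev] at h1 h2
        linarith
      · rw [hchi0 e he he', zero_add, sumExtend_apply_of_notMem _ he he']
        rfl

variable [Finite β]

/-- Each Voronoi cell is the projection of its component's cube, and this inner projection is
invisible to `proj G`. -/
theorem proj_image_vorSum : proj G '' vorSum G D = proj G '' cubeFace G D := by
  have key : ∀ y : (c : Component (removeEdges G D)) →
      CochainOne (componentGraph (removeEdges G D) c),
      proj G (sumExtend D fun c => proj _ (y c)) = proj G (sumExtend D y) := by
    intro y
    rw [sumExtend_apply, sumExtend_apply, map_sum, map_sum]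
    exact Finset.sum_congr rfl fun c _ => proj_extendByZero_proj (componentGraph_le D c) (y c)
  have hcube : ∀ c : Component (removeEdges G D),
      proj _ '' cube (0 : CochainOne (componentGraph (removeEdges G D) c)) = vorCell _ 0 := by
    intro c
    rw [← proj_image_cubeOn_empty, cubeOn_empty]
    simp [cube]
  rw [vorSum, cubeFace, add_comm, minkowskiSum_eq_image, minkowskiSum_eq_image,
    Set.singleton_add, Set.singleton_add]
  apply Set.Subset.antisymm
  · rintro _ ⟨_, ⟨_, ⟨z, hz, rfl⟩, rfl⟩, rfl⟩
    have hz' : ∀ c, ∃ y ∈ cube (0 : CochainOne (componentGraph (removeEdges G D) c)),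
        proj _ y = z c := fun c => by
      have hzc : z c ∈ vorCell _ 0 := hz c (Set.mem_univ c)
      rwa [← hcube c] at hzc
    choose y hy hyz using hz'
    refine ⟨_, ⟨_, ⟨y, fun c _ => hy c, rfl⟩, rfl⟩, ?_⟩
    simp only [map_add]
    rw [← key y, funext hyz]
  · rintro _ ⟨_, ⟨_, ⟨y, hy, rfl⟩, rfl⟩, rfl⟩
    refine ⟨_, ⟨_, ⟨fun c => proj _ (y c), fun c _ => ?_, rfl⟩, rfl⟩, ?_⟩
    · change proj _ (y c) ∈ vorCell _ 0
      rw [← hcube c]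
      exact ⟨_, hy c (Set.mem_univ c), rfl⟩
    · simp only [map_add, key]

/-- The projection to the cut space of `G` is injective on the sum of the cut spaces of the
components of `G - E(D)`. -/
lemma eq_zero_of_proj_sumExtend_eq_zero
    {y : (c : Component (removeEdges G D)) → CochainOne (componentGraph (removeEdges G D) c)}
    (hy : ∀ c, y c ∈ cutSpace (componentGraph (removeEdges G D) c))
    (h : proj G (sumExtend D y) = 0) : y = 0 := by
  obtain ⟨g, hg⟩ := exists_coboundary_restrictTo_eq y hy
  -- Pairing with the glued coboundary gives the sum of the squared norms of the `y c`.
  have h0 : inner ℝ (sumExtend D y) (coboundary G g) = 0 := by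
    rw [real_inner_comm, ← inner_proj_right ⟨g, rfl⟩, h, inner_zero_right]
  rw [sumExtend_apply, sum_inner] at h0
  have h1 : ∀ c, inner ℝ (extendByZero (componentGraph (removeEdges G D) c) G (y c))
      (coboundary G g) = inner ℝ (y c) (y c) := fun c => by
    rw [inner_extendByZero (componentGraph_le D c), hg c]
  rw [Finset.sum_congr rfl fun c _ => h1 c,
    Finset.sum_eq_zero_iff_of_nonneg fun c _ => real_inner_self_nonneg] at h0
  exact funext fun c => inner_self_eq_zero.mp (h0 c (Finset.mem_univ c))

/-- The affine span lies in a translate of `W`, the sum of the component cut spaces, on which the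
kernel is trivial. -/
lemma injOn_proj_affineSpan_vorSum :
    Set.InjOn (proj G) (affineSpan ℝ (vorSum G D) : Set (CochainOne G)) := by
  set W : Submodule ℝ (CochainOne G) :=
    (Submodule.pi Set.univ fun c => cutSpace (componentGraph (removeEdges G D) c)).map
      (sumExtend D) with hW
  have hle : affineSpan ℝ (vorSum G D) ≤ AffineSubspace.mk' ((1 / 2 : ℝ) • chi D) W := by
    rw [affineSpan_le, vorSum, add_comm, minkowskiSum_eq_image, Set.singleton_add]
    rintro _ ⟨_, ⟨y, hy, rfl⟩, rfl⟩
    rw [SetLike.mem_coe, AffineSubspace.mem_mk', vsub_eq_sub, add_sub_cancel_left]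
    exact ⟨y, fun c hc => (hy c hc).1, rfl⟩
  intro a ha b hb hab
  have hsub : a - b ∈ W := by
    have h1 := AffineSubspace.mem_mk'.mp (hle ha)
    have h2 := AffineSubspace.mem_mk'.mp (hle hb)
    rw [vsub_eq_sub] at h1 h2
    simpa using W.sub_mem h1 h2
  obtain ⟨y, hy, hyab⟩ := hsub
  have hy0 : y = 0 := eq_zero_of_proj_sumExtend_eq_zero (fun c => hy c (Set.mem_univ c)) (by
    rw [hyab, map_sub, hab, sub_self])
  rw [hy0, map_zero] at hyab
  exact sub_eq_zero.mp hyab.symm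

end Finite

end CutVoronoi

open CutVoronoi

theorem mainTheorem6 {α : Type*} {β : Type*} [Finite α] [Finite β]
    (G : Graph α β) [G.Loopless] (hG : G.toSimpleGraph.Connected)
    (D : Set (OrientedEdge G)) (hD : IsCoherentAcyclic G D) :
    (∃! f : Set (CochainOne G), IsFace (vorCell G 0) f ∧ faceOrientation G f = D) ∧
    ∀ f : Set (CochainOne G), IsFace (vorCell G 0) f → faceOrientation G f = D →
      proj G '' cubeFace G D = f ∧
      proj G '' intrinsicInterior ℝ (cubeFace G D) = intrinsicInterior ℝ f ∧
      (Set.BijOn (proj G) (vorSum G D) f ∧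
        Set.BijOn (proj G) (affineSpan ℝ (vorSum G D) : Set (CochainOne G))
          (affineSpan ℝ f : Set (CochainOne G))) := by
  obtain ⟨w, hw, rfl⟩ := hD.exists_posSupp_eq
  have huniq : ∀ f : Set (CochainOne G), IsFace (vorCell G 0) f →
      faceOrientation G f = posSupp w → f = proj G '' cubeOn (posSupp w) := by
    intro f hf hfo
    obtain ⟨w', hw', rfl⟩ := exists_of_isFace hf
    rw [faceOrientation_proj_image_cubeOn hG hw'] at hfo
    rw [hfo]
  refine ⟨⟨_, ⟨isFace_proj_image_cubeOn hw, faceOrientation_proj_image_cubeOn hG hw⟩,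
    fun f hf => huniq f hf.1 hf.2⟩, fun f hf hfo => ?_⟩
  have hface : proj G '' cubeFace G (posSupp w) = f := by
    rw [cubeFace_eq_cubeOn (rev_notMem_posSupp w), ← huniq f hf hfo]
  have hvor : proj G '' vorSum G (posSupp w) = f := proj_image_vorSum.trans hface
  have hinj := injOn_proj_affineSpan_vorSum (D := posSupp w)
  refine ⟨hface, ?_, ?_, ?_⟩
  · rw [← hface]
    refine image_intrinsicInterior_of_convex (proj G).toLinearMap ?_
    rw [cubeFace_eq_cubeOn (rev_notMem_posSupp w)]
    exact convex_cubeOn _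
  · rw [← hvor]
    exact (hinj.mono (subset_affineSpan ℝ _)).bijOn_image
  -- Affine spans commute with linear maps, so surjectivity onto the span of `f` is automatic.
  · have hmap := AffineSubspace.map_span (proj G).toLinearMap.toAffineMap (vorSum G (posSupp w))
    have himg : (affineSpan ℝ f : Set (CochainOne G)) =
        proj G '' (affineSpan ℝ (vorSum G (posSupp w)) : Set (CochainOne G)) := by
      rw [← hvor]
      exact (congrArg (fun S : AffineSubspace ℝ (CochainOne G) => (S : Set (CochainOne G)))
        hmap).symm
    rw [himg]
    exact hinj.bijOn_image
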